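/- Let $r\ge 2$ be an integer and let $f_r:[0,1]\to\mathbb{R}$ be the Takagi-Van der Waerden function $$f_r(x)=\sum_{n=0}^{\infty}\frac{1}{r^n}\,\phi(r^n x),$$ where $\phi(t)$ denotes the distance from $t\in\mathbb{R}$ to the nearest integer. For $x\in[0,1]$ write $f_r'(x)=-\infty$ if $$\lim_{\substack{y\to x\\ y\in[0,1],\ y\neq x}}\frac{f_r(y)-f_r(x)}{y-x}=-\infty .$$ Then the set $\{x\in[0,1]: f_r'(x)=-\infty\}$ has Lebesgue measure zero and Hausdorff dimension one. -/

import Mathlib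

open Set Filter Topology MeasureTheory

noncomputable section

/-- The distance from `x` to the nearest integer. -/
def distNearestInt (x : ℝ) : ℝ := |x - round x|

/-- The Takagi-Van der Waerden function `f_r(x) = ∑ φ(r ^ n x) / r ^ n`; only its values on
`[0,1]` are used. -/
def takagiVdW (r : ℕ) (x : ℝ) : ℝ :=
  ∑' n : ℕ, (1 / (r : ℝ) ^ n) * distNearestInt ((r : ℝ) ^ n * x)

/-- The series that defines `f_r` converges at every point when `r ≥ 2`. -/
theorem summable_takagiVdW {r : ℕ} (hr : 2 ≤ r) (x : ℝ) :
    Summable fun n : ℕ => (1 / (r : ℝ) ^ n) * distNearestInt ((r : ℝ) ^ n * x) := by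
  have h1 : (1 : ℝ) < r := by exact_mod_cast hr
  have hs : Summable fun n : ℕ => (1 / (r : ℝ)) ^ n :=
    summable_geometric_of_lt_one (by positivity) (by rw [div_lt_one (by linarith)]; exact h1)
  refine Summable.of_nonneg_of_le (fun n => ?_) (fun n => ?_) hs
  · unfold distNearestInt; positivity
  · have h2 : distNearestInt ((r : ℝ) ^ n * x) ≤ 1 := by
      unfold distNearestInt
      exact (abs_sub_round _).trans (by norm_num)
    rw [one_div_pow]
    exact mul_le_of_le_one_right (by positivity) h2

/-- The function `f`, regarded as a function on `[0,1]`, has derivative `-∞` at `x`: the difference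
quotients `(f y - f x) / (y - x)` tend to `-∞` as `y → x` with `y ∈ [0,1]` and `y ≠ x`. For
`0 < x < 1` this is a two-sided limit. -/
def HasDerivNegInf (f : ℝ → ℝ) (x : ℝ) : Prop :=
  Tendsto (fun y => (f y - f x) / (y - x)) (𝓝[Icc (0 : ℝ) 1 \ {x}] x) atBot

end

/-!
**Measure zero.** This holds for every function `f`. Near a point with derivative `-∞` the function
expands distances by arbitrarily large factors. Hence the set of these points is locally the image,
under an inverse of `f`, of a set on which that inverse has derivative zero, and Sard's lemma
applies (`volume_hasDerivNegInf`).

**Dimension one.** Write `ε(t) = ±1` for the slope at `t` of the distance to the nearest integer.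
The functional equation `f_r(x) = φ(x) + f_r(r x) / r` gives, for the difference quotients,
`Q(x, z) = ε(x) + Q(r x, r z)` as long as no point of `½ℤ` lies between `x` and `z`. If the points
`r ^ k x` keep a fixed distance from `½ℤ`, this can be iterated until the two points are about a
unit apart, where the quotient is bounded. So `f_r'(x) = -∞` as soon as also `∑_{k < n} ε(r ^ k x)`
tends to `-∞` (`hasDerivNegInf_takagiVdW`).

Such points are produced by concatenating blocks of base `r` digits. A block is a word of length
`m + 1` whose slopes have a sum at most zero, followed by the digits `r - 1`, `r - 1`, `0`. The
three final digits make the sum over the block at most `-1`, and they keep all dilates away from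
`½ℤ`, whatever the word is. Replacing each digit `d` by `r - 1 - d` reverses the signs of the
slopes, so at least one word out of each complementary pair is admissible, which leaves at least
`r ^ m` of the `r ^ (m + 1)` words (`descendingWord`). Sending a concatenation of blocks to the
number whose base `r ^ m` digits are the indices of its words is a Hölder map of exponent
`m / (m + 4)` from a set of points with derivative `-∞` onto `[0,1]`
(`abs_ofDigits_sub_le_rpow`), so that set has dimension at least `m / (m + 4)`, for every `m`.
-/

/-! ### Points of infinite derivative form a null set -/

/-- A set on which `f` expands distances, and expands them by an arbitrarily large factor near each
point, is null: it is the image under the inverse of `f` of the set `f '' B`, and this inverse has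
derivative zero everywhere, so that Sard's lemma applies. -/
theorem volume_eq_zero_of_steep {f : ℝ → ℝ} {B : Set ℝ}
    (hexp : ∀ x ∈ B, ∀ y ∈ B, |y - x| ≤ |f y - f x|)
    (hsteep : ∀ x ∈ B, ∀ M : ℝ, ∃ η > 0, ∀ y ∈ B, |y - x| < η → M * |y - x| ≤ |f y - f x|) :
    volume B = 0 := by
  have hinj : InjOn f B := by
    intro x hx y hy hxy
    have := hexp x hx y hy
    rw [hxy, sub_self, abs_zero, abs_nonpos_iff, sub_eq_zero] at this
    exact this.symm
  have hleft : LeftInvOn (Function.invFunOn f B) f B := hinj.leftInvOn_invFunOn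
  rw [← hleft.image_image]
  refine addHaar_image_eq_zero_of_det_fderivWithin_eq_zero volume (f' := fun _ => 0) ?_
    (fun _ _ => by simp)
  rintro _ ⟨x, hx, rfl⟩
  rw [hasFDerivWithinAt_iff_isLittleO, Asymptotics.isLittleO_iff]
  intro c hc
  obtain ⟨η, hη, h⟩ := hsteep x hx c⁻¹
  filter_upwards [self_mem_nhdsWithin, mem_nhdsWithin_of_mem_nhds (Metric.ball_mem_nhds _ hη)]
  rintro _ ⟨y, hy, rfl⟩ hball
  rw [Metric.mem_ball, Real.dist_eq] at hball
  rw [hleft hx, hleft hy]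
  have := h y hy ((hexp x hx y hy).trans_lt hball)
  rw [inv_mul_le_iff₀ hc] at this
  simpa using this

theorem HasDerivNegInf.exists_mul_abs_le {f : ℝ → ℝ} {x : ℝ} (h : HasDerivNegInf f x) (M : ℝ) :
    ∃ η > 0, ∀ y ∈ Icc (0 : ℝ) 1, |y - x| < η → M * |y - x| ≤ |f y - f x| := by
  have h1 := h.eventually (eventually_le_atBot (-M))
  rw [eventually_nhdsWithin_iff, Metric.eventually_nhds_iff] at h1
  obtain ⟨η, hη, h1⟩ := h1
  refine ⟨η, hη, fun y hy hyx => ?_⟩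
  rcases eq_or_ne y x with rfl | hne
  · simp
  have h2 := h1 (by rwa [Real.dist_eq]) ⟨hy, hne⟩
  have hpos : 0 < |y - x| := abs_pos.2 (sub_ne_zero.2 hne)
  rw [← le_div_iff₀ hpos, ← abs_div]
  exact (by linarith : M ≤ -((f y - f x) / (y - x))).trans (neg_le_abs _)

/-- No function has derivative `-∞` on a set of positive measure. -/
theorem volume_hasDerivNegInf (f : ℝ → ℝ) :
    volume {x : ℝ | x ∈ Icc (0 : ℝ) 1 ∧ HasDerivNegInf f x} = 0 := by
  set A := {x : ℝ | x ∈ Icc (0 : ℝ) 1 ∧ HasDerivNegInf f x} with hA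
  let B : ℕ → Set ℝ := fun n =>
    {x ∈ A | ∀ y ∈ Icc (0 : ℝ) 1, |y - x| < 1 / ((n : ℝ) + 1) → |y - x| ≤ |f y - f x|}
  have hcover : A ⊆ ⋃ n, B n := by
    intro x hx
    obtain ⟨η, hη, h⟩ := hx.2.exists_mul_abs_le 1
    obtain ⟨n, hn⟩ := exists_nat_one_div_lt hη
    exact mem_iUnion.2 ⟨n, hx, fun y hy hyx => by simpa using h y hy (hyx.trans hn)⟩
  refine measure_mono_null hcover (measure_iUnion_null fun n => ?_)
  refine measure_null_of_locally_null _ fun x _ => ?_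
  -- on a set of diameter below `1 / (n + 1)` the defining property of `B n` is a global expansion
  refine ⟨B n ∩ Metric.ball x (1 / ((n : ℝ) + 1) / 2),
    inter_mem_nhdsWithin _ (Metric.ball_mem_nhds _ (by positivity)), ?_⟩
  refine volume_eq_zero_of_steep (f := f) ?_ ?_
  · rintro u ⟨hu, hu'⟩ v ⟨hv, hv'⟩
    refine hu.2 v hv.1.1 ?_
    rw [Metric.mem_ball, Real.dist_eq, abs_lt] at hu' hv'
    rw [abs_lt]
    constructor <;> linarith [hu'.1, hu'.2, hv'.1, hv'.2]
  · rintro u ⟨hu, -⟩ M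
    obtain ⟨η, hη, h⟩ := hu.1.2.exists_mul_abs_le M
    exact ⟨η, hη, fun y hy => h y hy.1.1.1⟩

/-! ### A sufficient condition for the derivative to be minus infinity -/

theorem distNearestInt_eq_abs {t : ℝ} {n : ℤ} (h : |t - n| ≤ 1 / 2) :
    distNearestInt t = |t - n| := by
  refine le_antisymm (round_le t n) ?_
  by_contra! hlt
  unfold distNearestInt at hlt
  have h1 : |(n : ℝ) - round t| < 1 := by
    rw [abs_lt]
    obtain ⟨h2, h3⟩ := abs_le.1 h
    obtain ⟨h4, h5⟩ := abs_lt.1 (hlt.trans_le h)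
    constructor <;> linarith
  have h2 : n = round t := by
    have : |n - round t| < 1 := by exact_mod_cast h1
    rw [Int.abs_lt_one_iff] at this
    linarith
  rw [← h2] at hlt
  exact lt_irrefl _ hlt

/-- The slope of the distance to the nearest integer at `t`, when `2 * t` is not an integer. -/
noncomputable def tentSlope (t : ℝ) : ℝ := if Int.fract t < 1 / 2 then 1 else -1

theorem tentSlope_le_one (t : ℝ) : tentSlope t ≤ 1 := by
  unfold tentSlope; split_ifs <;> norm_num

theorem tentSlope_eq_of_add {t v : ℝ} (n : ℤ) (h : t = n + v) (h0 : 0 ≤ v) (h1 : v < 1) :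
    tentSlope t = if v < 1 / 2 then 1 else -1 := by
  have : Int.fract t = v := Int.fract_eq_iff.2 ⟨h0, h1, n, by rw [h]; ring⟩
  rw [tentSlope, this]

/-- The distance to the nearest integer is affine on an interval whose interior contains no
integer and no half-integer. -/
theorem distNearestInt_sub {t u δ : ℝ} (hδ : ∀ p : ℤ, δ ≤ |t - p / 2|) (hu : |u - t| ≤ δ) :
    distNearestInt u - distNearestInt t = tentSlope t * (u - t) := by
  obtain ⟨hu1, hu2⟩ := abs_le.1 hu
  have hδ0 : 0 ≤ δ := (abs_nonneg _).trans hu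
  have h0 := Int.fract_nonneg t
  have h1 := Int.fract_lt_one t
  have ht : t = ⌊t⌋ + Int.fract t := (Int.floor_add_fract t).symm
  have hfl := hδ (2 * ⌊t⌋)
  have hmid := hδ (2 * ⌊t⌋ + 1)
  have hce := hδ (2 * ⌊t⌋ + 2)
  push_cast at hfl hmid hce
  rw [abs_of_nonneg (by linarith)] at hfl
  rw [abs_of_nonpos (by linarith)] at hce
  by_cases hlt : Int.fract t < 1 / 2
  · rw [abs_of_nonpos (by linarith)] at hmid
    have hA : |t - ⌊t⌋| = t - ⌊t⌋ := abs_of_nonneg (by linarith)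
    have hB : |u - ⌊t⌋| = u - ⌊t⌋ := abs_of_nonneg (by linarith)
    rw [distNearestInt_eq_abs (n := ⌊t⌋) (by rw [hB]; linarith),
      distNearestInt_eq_abs (n := ⌊t⌋) (by rw [hA]; linarith), hB, hA, tentSlope, if_pos hlt]
    ring
  · have hge : 1 / 2 ≤ Int.fract t := not_lt.1 hlt
    rw [abs_of_nonneg (by linarith)] at hmid
    have hA : |t - (⌊t⌋ + 1 : ℤ)| = ⌊t⌋ + 1 - t := by
      push_cast; rw [abs_of_nonpos (by linarith)]; ring
    have hB : |u - (⌊t⌋ + 1 : ℤ)| = ⌊t⌋ + 1 - u := by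
      push_cast; rw [abs_of_nonpos (by linarith)]; ring
    rw [distNearestInt_eq_abs (n := ⌊t⌋ + 1) (by rw [hB]; linarith),
      distNearestInt_eq_abs (n := ⌊t⌋ + 1) (by rw [hA]; linarith), hB, hA, tentSlope, if_neg hlt]
    ring

theorem takagiVdW_eq_add {r : ℕ} (hr : 2 ≤ r) (x : ℝ) :
    takagiVdW r x = distNearestInt x + (1 / r) * takagiVdW r (r * x) := by
  unfold takagiVdW
  rw [(summable_takagiVdW hr x).tsum_eq_zero_add, ← tsum_mul_left]
  simp only [pow_zero, div_one, one_mul]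
  congr 1
  refine tsum_congr fun n => ?_
  rw [pow_succ, ← mul_assoc ((r : ℝ) ^ n) r x]
  have : (r : ℝ) ≠ 0 := by positivity
  field_simp

theorem takagiVdW_mem_Icc {r : ℕ} (hr : 2 ≤ r) (x : ℝ) : takagiVdW r x ∈ Icc (0 : ℝ) 1 := by
  have h2 : (2 : ℝ) ≤ r := by exact_mod_cast hr
  refine ⟨tsum_nonneg fun n => by unfold distNearestInt; positivity, ?_⟩
  have hg := hasSum_geometric_two
  have hs : HasSum (fun n : ℕ => (1 / 2 : ℝ) ^ n * (1 / 2)) 1 := by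
    simpa using hg.mul_right (1 / 2 : ℝ)
  refine hasSum_le (fun n => ?_) (summable_takagiVdW hr x).hasSum hs
  have h3 : distNearestInt ((r : ℝ) ^ n * x) ≤ 1 / 2 := abs_sub_round _
  have h4 : 0 ≤ distNearestInt ((r : ℝ) ^ n * x) := abs_nonneg _
  rw [← one_div_pow]
  gcongr

/-- As long as the dilates of `x` by `r ^ k` stay away from `½ℤ`, the first `n` terms of the series
contribute the sum of their slopes to a difference quotient at scale `r⁻ⁿ`. -/
theorem takagiVdW_slope_eq {r : ℕ} (hr : 2 ≤ r) {δ x z : ℝ} (hxz : z ≠ x)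
    (hδ : ∀ (k : ℕ) (p : ℤ), δ ≤ |(r : ℝ) ^ k * x - p / 2|) (n : ℕ)
    (hz : ∀ k < n, (r : ℝ) ^ k * |z - x| ≤ δ) :
    (takagiVdW r z - takagiVdW r x) / (z - x) =
      ∑ k ∈ Finset.range n, tentSlope ((r : ℝ) ^ k * x) +
        (takagiVdW r ((r : ℝ) ^ n * z) - takagiVdW r ((r : ℝ) ^ n * x)) /
          ((r : ℝ) ^ n * (z - x)) := by
  have hr0 : (r : ℝ) ≠ 0 := by positivity
  have hzx : z - x ≠ 0 := sub_ne_zero.2 hxz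
  induction n with
  | zero => simp
  | succ n ih =>
    rw [ih fun k hk => hz k (hk.trans n.lt_succ_self), Finset.sum_range_succ, add_assoc]
    congr 1
    have h1 : |(r : ℝ) ^ n * z - (r : ℝ) ^ n * x| ≤ δ := by
      rw [← mul_sub, abs_mul, abs_of_nonneg (by positivity)]
      exact hz n n.lt_succ_self
    have h2 := distNearestInt_sub (hδ n) h1
    rw [takagiVdW_eq_add hr ((r : ℝ) ^ n * z), takagiVdW_eq_add hr ((r : ℝ) ^ n * x),
      ← mul_assoc (r : ℝ), ← mul_assoc (r : ℝ), ← pow_succ']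
    rw [← mul_sub] at h2
    have h3 : distNearestInt ((r : ℝ) ^ n * z) = distNearestInt ((r : ℝ) ^ n * x) +
      tentSlope ((r : ℝ) ^ n * x) * ((r : ℝ) ^ n * (z - x)) := by linarith
    rw [h3, pow_succ']
    field_simp
    ring

/-- If the dilates `r ^ k * x` keep a fixed distance from `½ℤ` and the slopes of the partial sums of
the series at `x` tend to `-∞`, then so do the difference quotients of the sum: at distance about
`r⁻ⁿ` the terms from the `n`-th on contribute only a bounded amount. -/
theorem hasDerivNegInf_takagiVdW {r : ℕ} (hr : 2 ≤ r) {δ x : ℝ} (hδ0 : 0 < δ)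
    (hδ : ∀ (k : ℕ) (p : ℤ), δ ≤ |(r : ℝ) ^ k * x - p / 2|)
    (hS : Tendsto (fun n => ∑ k ∈ Finset.range n, tentSlope ((r : ℝ) ^ k * x)) atTop atBot) :
    HasDerivNegInf (takagiVdW r) x := by
  have h1r : (1 : ℝ) < r := by exact_mod_cast hr
  have hr0 : (0 : ℝ) < r := by linarith
  refine tendsto_atBot.2 fun M => ?_
  obtain ⟨N, hN⟩ := (tendsto_atBot.1 hS (M - 1 / δ)).exists_forall_of_atTop
  rw [eventually_nhdsWithin_iff, Metric.eventually_nhds_iff]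
  refine ⟨δ * (r : ℝ)⁻¹ ^ N, by positivity, fun z hz hzx => ?_⟩
  have hne : z ≠ x := hzx.2
  have hpos : 0 < |z - x| := abs_pos.2 (sub_ne_zero.2 hne)
  rw [Real.dist_eq, mul_comm, ← div_lt_iff₀ hδ0] at hz
  have hinv : (r : ℝ)⁻¹ < 1 := inv_lt_one_of_one_lt₀ h1r
  obtain ⟨n, hn1, hn2⟩ := exists_nat_pow_near_of_lt_one (x := |z - x| / δ) (y := (r : ℝ)⁻¹)
    (by positivity) (hz.le.trans (pow_le_one₀ (by positivity) hinv.le)) (by positivity) hinv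
  have hNn : N < n + 1 := (pow_lt_pow_iff_right_of_lt_one₀ (by positivity) hinv).1 (hn1.trans hz)
  rw [inv_pow, inv_lt_iff_one_lt_mul₀ (by positivity), div_mul_eq_mul_div, lt_div_iff₀ hδ0,
    one_mul, mul_comm] at hn1
  rw [div_le_iff₀ hδ0, inv_pow, ← div_eq_inv_mul, le_div_iff₀ (by positivity)] at hn2
  rw [takagiVdW_slope_eq hr hne hδ (n + 1) fun k hk => ?_]
  · have hb : (takagiVdW r ((r : ℝ) ^ (n + 1) * z) - takagiVdW r ((r : ℝ) ^ (n + 1) * x)) /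
          ((r : ℝ) ^ (n + 1) * (z - x)) ≤ 1 / δ := by
      refine (le_abs_self _).trans ?_
      rw [abs_div, abs_mul, abs_of_nonneg (by positivity : (0 : ℝ) ≤ (r : ℝ) ^ (n + 1))]
      obtain ⟨h1, h2⟩ := takagiVdW_mem_Icc hr ((r : ℝ) ^ (n + 1) * z)
      obtain ⟨h3, h4⟩ := takagiVdW_mem_Icc hr ((r : ℝ) ^ (n + 1) * x)
      exact div_le_div₀ zero_le_one (abs_le.2 ⟨by linarith, by linarith⟩) hδ0 hn1.le
    linarith [hN (n + 1) hNn.le]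
  · calc (r : ℝ) ^ k * |z - x| ≤ (r : ℝ) ^ n * |z - x| := by
          gcongr
          · exact h1r.le
          · omega
      _ ≤ δ := by linarith

/-! ### Words with nonpositive total slope -/

/-- The slope of the distance to the nearest integer at the points `(w + θ) / q` with
`1 / 2 ≤ θ < 1`. -/
noncomputable def cellSlope (q w : ℕ) : ℝ := if 2 * (w % q) + 1 < q then 1 else -1

/-- The sum of the first `m` slopes `tentSlope (r ^ j * y)` at `y = (w + θ) / r ^ m` with
`1 / 2 ≤ θ < 1`; the number `w` stands for the word formed by its last `m` digits in base `r`. -/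
noncomputable def wordSlope (r m w : ℕ) : ℝ := ∑ j ∈ Finset.range m, cellSlope (r ^ (m - j)) w

theorem tentSlope_div {q : ℕ} (hq : 0 < q) (w : ℕ) {θ : ℝ} (h0 : 1 / 2 ≤ θ) (h1 : θ < 1) :
    tentSlope ((w + θ) / q) = cellSlope q w := by
  have hq' : (0 : ℝ) < q := by exact_mod_cast hq
  have hlt : ((w % q : ℕ) : ℝ) + 1 ≤ q := by exact_mod_cast Nat.mod_lt w hq
  have hw : (w : ℝ) = q * (w / q : ℕ) + (w % q : ℕ) := by exact_mod_cast (Nat.div_add_mod w q).symm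
  rw [tentSlope_eq_of_add (v := ((w % q : ℕ) + θ) / q) ((w / q : ℕ) : ℤ) ?_ (by positivity)
    (by rw [div_lt_one hq']; linarith), cellSlope]
  · refine if_congr ?_ rfl rfl
    rw [div_lt_iff₀ hq']
    constructor
    · intro h
      have : 2 * ((w % q : ℕ) : ℝ) + 1 < q := by linarith
      exact_mod_cast this
    · intro h
      have : 2 * ((w % q : ℕ) : ℝ) + 2 ≤ q := by exact_mod_cast h
      linarith
  · rw [Int.cast_natCast]
    field_simp
    linarith

theorem cellSlope_add_mul (q k w : ℕ) : cellSlope q (q * k + w) = cellSlope q w := by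
  unfold cellSlope
  rw [Nat.mul_add_mod]

theorem wordSlope_mul_add (r m k w : ℕ) : wordSlope r m (r ^ m * k + w) = wordSlope r m w := by
  refine Finset.sum_congr rfl fun j hj => ?_
  have : r ^ m = r ^ (m - j) * r ^ j := by
    rw [← pow_add, Nat.sub_add_cancel (Finset.mem_range.1 hj).le]
  rw [this, mul_assoc, cellSlope_add_mul]

theorem cellSlope_add_cellSlope_le {q n w v : ℕ} (hq : q ∣ n) (h : w + v + 1 = n) :
    cellSlope q w + cellSlope q v ≤ 0 := by
  -- two remainders below `(q - 1) / 2` cannot add up to `-1` modulo `q`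
  have key : ¬ (2 * (w % q) + 1 < q ∧ 2 * (v % q) + 1 < q) := by
    rintro ⟨h1, h2⟩
    have h3 : q ∣ w % q + v % q + 1 := by
      have h4 : w % q + v % q + 1 ≡ w + v + 1 [MOD q] :=
        ((Nat.mod_modEq w q).add (Nat.mod_modEq v q)).add_right 1
      exact (h4.dvd_iff dvd_rfl).2 (h ▸ hq)
    have := Nat.le_of_dvd (by omega) h3
    omega
  unfold cellSlope
  split_ifs with h1 h2
  · exact absurd ⟨h1, h2⟩ key
  all_goals norm_num

/-- Replacing every digit `d` of a word by `r - 1 - d` reverses the sign of its slope, up to ties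
which are counted as negative. -/
theorem wordSlope_add_wordSlope_le {r m w v : ℕ} (h : w + v + 1 = r ^ m) :
    wordSlope r m w + wordSlope r m v ≤ 0 := by
  rw [wordSlope, wordSlope, ← Finset.sum_add_distrib]
  exact Finset.sum_nonpos fun j _ => cellSlope_add_cellSlope_le (pow_dvd_pow r (m.sub_le j)) h

/-- One of the two mutually complementary words `i` and `r ^ m - 1 - i` with nonpositive slope. -/
noncomputable def descendingWord (r m i : ℕ) : ℕ :=
  if wordSlope r m i ≤ 0 then i else r ^ m - 1 - i

theorem descendingWord_lt {r m i : ℕ} (hi : i < r ^ m) : descendingWord r m i < r ^ m := by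
  unfold descendingWord
  split_ifs <;> omega

theorem wordSlope_descendingWord {r m i : ℕ} (hi : i < r ^ m) :
    wordSlope r m (descendingWord r m i) ≤ 0 := by
  unfold descendingWord
  split_ifs with h
  · exact h
  · have := wordSlope_add_wordSlope_le (r := r) (m := m) (w := i) (v := r ^ m - 1 - i) (by omega)
    linarith

theorem descendingWord_inj {r m i j : ℕ} (hi : 2 * i < r ^ m) (hj : 2 * j < r ^ m)
    (h : descendingWord r m i = descendingWord r m j) : i = j := by
  unfold descendingWord at h
  split_ifs at h with h1 h2 <;> omega

/-! ### The Cantor sets -/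

/-- The digit in base `r ^ (m + 3)` that is made up of the word `w` of length `m` in base `r` and
the three digits `r - 1`, `r - 1`, `0`. -/
def blockDigit (r w : ℕ) : ℕ := (w + 1) * r ^ 3 - r

theorem blockDigit_add (r w : ℕ) : blockDigit r w + r = (w + 1) * r ^ 3 := by
  have : r ≤ (w + 1) * r ^ 3 := by nlinarith [Nat.le_self_pow three_ne_zero r]
  unfold blockDigit
  omega

theorem cast_blockDigit (r w : ℕ) :
    (blockDigit r w : ℝ) = (w + 1) * (r : ℝ) ^ 3 - r := by
  have : (blockDigit r w : ℝ) + r = (w + 1) * (r : ℝ) ^ 3 := by exact_mod_cast blockDigit_add r w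
  linarith

theorem blockDigit_add_le {r m w : ℕ} (hw : w < r ^ m) :
    blockDigit r w + r ≤ r ^ (m + 3) := by
  rw [blockDigit_add, pow_add]
  gcongr
  exact hw

theorem one_le_blockDigit {r : ℕ} (hr : 2 ≤ r) (w : ℕ) : 1 ≤ blockDigit r w := by
  have h := blockDigit_add r w
  have : 2 * 2 * r ≤ r ^ 3 := by
    rw [show r ^ 3 = r * r * r by ring]; gcongr
  nlinarith

/-- The three digits `r - 1`, `r - 1`, `0` at the end of a block contribute at most `-1` to the sum
of the slopes. -/
theorem sum_tentSlope_block_le {r : ℕ} (hr : 2 ≤ r) (m W : ℕ) {η : ℝ} (h0 : 0 ≤ η) (h1 : η < 1) :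
    ∑ j ∈ Finset.range (m + 3),
      tentSlope ((r : ℝ) ^ j * ((blockDigit r W + η) / (r : ℝ) ^ (m + 3))) ≤
        wordSlope r m W - 1 := by
  have hr2 : (2 : ℝ) ≤ r := by exact_mod_cast hr
  have hr0 : (0 : ℝ) < r := by linarith
  rw [cast_blockDigit]
  have hθ : ((W + 1) * (r : ℝ) ^ 3 - r + η) / (r : ℝ) ^ (m + 3) =
      (W + (1 - (r - η) / (r : ℝ) ^ 3)) / (r : ℝ) ^ m := by
    rw [pow_add]; field_simp; ring
  -- the slopes at the digits of the word
  have hword : ∑ j ∈ Finset.range m,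
      tentSlope ((r : ℝ) ^ j * (((W + 1) * (r : ℝ) ^ 3 - r + η) / (r : ℝ) ^ (m + 3))) =
        wordSlope r m W := by
    refine Finset.sum_congr rfl fun j hj => ?_
    have hm : (r : ℝ) ^ m = (r : ℝ) ^ (m - j) * (r : ℝ) ^ j := by
      rw [← pow_add, Nat.sub_add_cancel (Finset.mem_range.1 hj).le]
    rw [hθ, ← tentSlope_div (q := r ^ (m - j)) (by positivity) W
      (θ := 1 - (r - η) / (r : ℝ) ^ 3)]
    · congr 1
      rw [hm]; push_cast; field_simp
    · have : (r - η) / (r : ℝ) ^ 3 ≤ 1 / 2 := by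
        rw [div_le_iff₀ (by positivity)]; nlinarith [mul_nonneg hr0.le (sq_nonneg ((r : ℝ) - 2))]
      linarith
    · have : 0 < (r - η) / (r : ℝ) ^ 3 := div_pos (by linarith) (by positivity)
      linarith
  have hfirst : tentSlope ((r : ℝ) ^ m *
      (((W + 1) * (r : ℝ) ^ 3 - r + η) / (r : ℝ) ^ (m + 3))) = -1 := by
    rw [tentSlope_eq_of_add (v := 1 - (r - η) / (r : ℝ) ^ 3) W, if_neg]
    · rw [not_lt]
      have : (r - η) / (r : ℝ) ^ 3 ≤ 1 / 2 := by
        rw [div_le_iff₀ (by positivity)]; nlinarith [mul_nonneg hr0.le (sq_nonneg ((r : ℝ) - 2))]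
      linarith
    · rw [hθ]; push_cast; field_simp
    · rw [sub_nonneg, div_le_one (by positivity)]
      nlinarith [mul_nonneg hr0.le (sq_nonneg ((r : ℝ) - 2))]
    · have : 0 < (r - η) / (r : ℝ) ^ 3 := div_pos (by linarith) (by positivity)
      linarith
  have hsecond : tentSlope ((r : ℝ) ^ (m + 1) *
      (((W + 1) * (r : ℝ) ^ 3 - r + η) / (r : ℝ) ^ (m + 3))) = -1 := by
    rw [tentSlope_eq_of_add (v := 1 - (r - η) / (r : ℝ) ^ 2) (W * r + r - 1), if_neg]
    · rw [not_lt]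
      have : (r - η) / (r : ℝ) ^ 2 ≤ 1 / 2 := by
        rw [div_le_iff₀ (by positivity)]; nlinarith
      linarith
    · rw [hθ, pow_succ]; push_cast; field_simp; ring
    · rw [sub_nonneg, div_le_one (by positivity)]
      nlinarith
    · have : 0 < (r - η) / (r : ℝ) ^ 2 := div_pos (by linarith) (by positivity)
      linarith
  rw [Finset.sum_range_succ, Finset.sum_range_succ, Finset.sum_range_succ, hword, hfirst, hsecond]
  linarith [tentSlope_le_one ((r : ℝ) ^ (m + 2) *
    (((W + 1) * (r : ℝ) ^ 3 - r + η) / (r : ℝ) ^ (m + 3)))]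

/-- The digits in base `r ^ (m + 1 + 3)` of a point of the Cantor set, as a function of an arbitrary
sequence `b` of `r ^ m` symbols. -/
noncomputable def blockSeq {r m : ℕ} (hr : 2 ≤ r) (b : ℕ → Fin (r ^ m)) (i : ℕ) :
    Fin (r ^ (m + 1 + 3)) :=
  ⟨blockDigit r (descendingWord r (m + 1) (b i)), by
    have h1 : (b i : ℕ) < r ^ (m + 1) :=
      (b i).2.trans_le (Nat.pow_le_pow_right (by omega) m.le_succ)
    have := blockDigit_add_le (descendingWord_lt h1)
    omega⟩

theorem two_mul_lt_pow_succ {r m i : ℕ} (hr : 2 ≤ r) (hi : i < r ^ m) : 2 * i < r ^ (m + 1) := by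
  rw [pow_succ]
  nlinarith

theorem mul_ofDigits {b : ℕ} (d : ℕ → Fin b) :
    (b : ℝ) * Real.ofDigits d = d 0 + Real.ofDigits fun k => d (k + 1) := by
  have hb : (b : ℝ) ≠ 0 := by
    have := (d 0).pos
    positivity
  rw [Real.ofDigits_eq_sum_add_ofDigits d 1]
  simp only [Finset.sum_range_one, Real.ofDigitsTerm, zero_add, pow_one]
  field_simp

theorem exists_pow_mul_ofDigits {b : ℕ} (d : ℕ → Fin b) (i : ℕ) :
    ∃ A : ℕ, (b : ℝ) ^ i * Real.ofDigits d = A + Real.ofDigits fun k => d (k + i) := by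
  induction i with
  | zero => exact ⟨0, by simp⟩
  | succ i ih =>
    obtain ⟨A, hA⟩ := ih
    refine ⟨b * A + d i, ?_⟩
    rw [pow_succ', mul_assoc, hA, mul_add, mul_ofDigits]
    push_cast
    rw [zero_add, add_assoc]
    simp only [add_assoc, add_comm 1 i]

/-- Digits that differ by at least two separate the numbers they represent. -/
theorem inv_pow_le_abs_ofDigits_sub {b n : ℕ} {d e : ℕ → Fin b} (h : ∀ i < n, d i = e i)
    (hn : (2 : ℝ) ≤ |(d n : ℝ) - (e n : ℝ)|) :
    ((b : ℝ) ^ (n + 1))⁻¹ ≤ |Real.ofDigits d - Real.ofDigits e| := by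
  have hb : (0 : ℝ) < b := by
    have := (d 0).pos
    positivity
  have hsum : ∑ i ∈ Finset.range (n + 1), Real.ofDigitsTerm d i -
      ∑ i ∈ Finset.range (n + 1), Real.ofDigitsTerm e i =
        ((d n : ℝ) - (e n : ℝ)) * ((b : ℝ) ^ (n + 1))⁻¹ := by
    have hcongr : ∑ i ∈ Finset.range n, Real.ofDigitsTerm d i =
        ∑ i ∈ Finset.range n, Real.ofDigitsTerm e i :=
      Finset.sum_congr rfl fun i hi => by
        simp only [Real.ofDigitsTerm, h i (Finset.mem_range.1 hi)]
    rw [Finset.sum_range_succ, Finset.sum_range_succ, hcongr, add_sub_add_left_eq_sub,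
      Real.ofDigitsTerm, Real.ofDigitsTerm, sub_mul]
  rw [Real.ofDigits_eq_sum_add_ofDigits d (n + 1), Real.ofDigits_eq_sum_add_ofDigits e (n + 1)]
  set u := Real.ofDigits fun i => d (i + (n + 1)) with hu
  set v := Real.ofDigits fun i => e (i + (n + 1)) with hv
  have huv : |v - u| ≤ 1 := by
    have h1 := Real.ofDigits_nonneg fun i => d (i + (n + 1))
    have h2 := Real.ofDigits_le_one fun i => d (i + (n + 1))
    have h3 := Real.ofDigits_nonneg fun i => e (i + (n + 1))
    have h4 := Real.ofDigits_le_one fun i => e (i + (n + 1))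
    exact abs_le.2 ⟨by linarith, by linarith⟩
  have h1 : 1 ≤ |((d n : ℝ) - (e n : ℝ)) - (v - u)| := by
    have := abs_sub_abs_le_abs_sub ((d n : ℝ) - (e n : ℝ)) (v - u)
    linarith
  rw [add_sub_add_comm, hsum, ← mul_sub, mul_comm, ← mul_add, abs_mul,
    abs_of_pos (by positivity : (0 : ℝ) < ((b : ℝ) ^ (n + 1))⁻¹),
    show (d n : ℝ) - (e n : ℝ) + (u - v) = ((d n : ℝ) - (e n : ℝ)) - (v - u) by ring]
  exact le_mul_of_one_le_right (by positivity) h1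

section BlockSeq

variable {r m : ℕ} (hr : 2 ≤ r) (b : ℕ → Fin (r ^ m))

/-- Multiplication by the `(i + 1)`-st power of the base splits a point of the Cantor set into the
integer formed by its first `i + 1` blocks and another such point. That integer is again of the form
`blockDigit r W`, where the last `m + 1` digits of `W` are the word of the block with index `i`. -/
theorem exists_pow_mul_ofDigits_blockSeq (i : ℕ) :
    ∃ W : ℕ, ((r : ℝ) ^ (m + 1 + 3)) ^ (i + 1) * Real.ofDigits (blockSeq hr b) =
      blockDigit r W + Real.ofDigits (blockSeq hr fun k => b (k + (i + 1))) ∧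
      wordSlope r (m + 1) W ≤ 0 := by
  have hb : (b i : ℕ) < r ^ (m + 1) :=
    (b i).2.trans_le (Nat.pow_le_pow_right (by omega) m.le_succ)
  obtain ⟨A, hA⟩ := exists_pow_mul_ofDigits (blockSeq hr b) i
  refine ⟨r ^ (m + 1) * A + descendingWord r (m + 1) (b i), ?_, ?_⟩
  · have h1 := mul_ofDigits fun k => blockSeq hr b (k + i)
    push_cast at hA h1
    rw [pow_succ', mul_assoc, hA, mul_add, h1, cast_blockDigit, zero_add]
    have h2 : ((blockSeq hr b i : ℕ) : ℝ) = blockDigit r (descendingWord r (m + 1) (b i)) := rfl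
    have h3 : (fun k => blockSeq hr b (k + 1 + i)) =
        blockSeq hr fun k => b (k + (i + 1)) := by
      funext k
      simp only [blockSeq, add_assoc, add_comm 1 i]
    rw [h2, h3, cast_blockDigit]
    push_cast
    ring
  · rw [wordSlope_mul_add]
    exact wordSlope_descendingWord hb

theorem ofDigits_blockSeq_mem_Icc :
    Real.ofDigits (blockSeq hr b) ∈
      Icc (1 / (r : ℝ) ^ (m + 1 + 3)) (1 - 1 / (r : ℝ) ^ (m + 1 + 3)) := by
  have hb : (b 0 : ℕ) < r ^ (m + 1) :=
    (b 0).2.trans_le (Nat.pow_le_pow_right (by omega) m.le_succ)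
  have h := mul_ofDigits (blockSeq hr b)
  have h0 := Real.ofDigits_nonneg fun k => blockSeq hr b (k + 1)
  have h1 := Real.ofDigits_le_one fun k => blockSeq hr b (k + 1)
  have h2 : (1 : ℝ) ≤ (blockSeq hr b 0 : ℕ) := by exact_mod_cast one_le_blockDigit hr _
  have h3 : ((blockSeq hr b 0 : ℕ) : ℝ) + r ≤ (r : ℝ) ^ (m + 1 + 3) := by
    exact_mod_cast blockDigit_add_le (descendingWord_lt hb)
  have hr2 : (2 : ℝ) ≤ r := by exact_mod_cast hr
  have hR : (0 : ℝ) < (r : ℝ) ^ (m + 1 + 3) := by positivity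
  push_cast at h
  constructor
  · rw [div_le_iff₀ hR]; linarith
  · rw [one_sub_div hR.ne', le_div_iff₀ hR]; linarith

/-- The points of the Cantor set satisfy the separation hypothesis of `hasDerivNegInf_takagiVdW`.
Looking ahead to the end of a complete block, the point is congruent to `-r + η` modulo `r ^ 2`
in units of the last digit, with `η` strictly between `0` and `1`, so twice this number is not a
multiple of `r ^ 2`. -/
theorem le_abs_pow_mul_ofDigits_blockSeq_sub (k : ℕ) (p : ℤ) :
    1 / (r : ℝ) ^ (2 * (m + 1 + 3) + 2) ≤
      |(r : ℝ) ^ k * Real.ofDigits (blockSeq hr b) - p / 2| := by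
  have hr2 : (2 : ℝ) ≤ r := by exact_mod_cast hr
  have hr0 : (0 : ℝ) < r := by linarith
  set L := m + 1 + 3 with hL
  set i := (k + 2) / L with hi
  obtain ⟨W, hW, -⟩ := exists_pow_mul_ofDigits_blockSeq hr b i
  obtain ⟨hη0, hη1⟩ := ofDigits_blockSeq_mem_Icc hr fun k => b (k + (i + 1))
  set η := Real.ofDigits (blockSeq hr fun k => b (k + (i + 1)))
  set x := Real.ofDigits (blockSeq hr b)
  rw [← hL, ← pow_mul] at hW
  rw [← hL] at hη0 hη1
  have hLi : L * i ≤ k + 2 := Nat.mul_div_le _ _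
  have hLi' : k + 2 < L * (i + 1) := Nat.lt_mul_div_succ (k + 2) (by omega)
  obtain ⟨e, he⟩ : ∃ e, L * (i + 1) = k + (e + 2) := ⟨L * (i + 1) - k - 2, by omega⟩
  have heL : e + 2 ≤ L + 2 := by rw [mul_add] at he; omega
  have hR : (0 : ℝ) < (r : ℝ) ^ L := by positivity
  have hq : 0 < 1 / (r : ℝ) ^ L := by positivity
  -- twice the distance, in units of the last digit of the block
  have hdist : 2 / (r : ℝ) ^ L ≤ |2 * (blockDigit r W + η) - p * (r : ℝ) ^ (e + 2)| := by
    have h2 : 2 / (r : ℝ) ^ L = 2 * (1 / (r : ℝ) ^ L) := by ring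
    have hK : 2 * (blockDigit r W + η) - p * (r : ℝ) ^ (e + 2) =
        (r : ℝ) ^ 2 * ((2 * (W + 1) * r - p * r ^ e : ℤ) : ℝ) - 2 * r + 2 * η := by
      rw [cast_blockDigit]; push_cast; ring
    rw [hK, h2]
    generalize (2 * (W + 1) * r - p * r ^ e : ℤ) = K
    rcases le_or_gt K 0 with hK0 | hK0
    · have : (K : ℝ) ≤ 0 := by exact_mod_cast hK0
      have := mul_nonpos_of_nonneg_of_nonpos (sq_nonneg (r : ℝ)) this
      exact le_abs.2 (Or.inr (by linarith))
    · have : (1 : ℝ) ≤ K := by exact_mod_cast hK0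
      exact le_abs.2 (Or.inl (by nlinarith [sq_nonneg (r : ℝ)]))
  have hx : (r : ℝ) ^ k * x - p / 2 =
      (2 * (blockDigit r W + η) - p * (r : ℝ) ^ (e + 2)) / (2 * (r : ℝ) ^ (e + 2)) := by
    rw [← hW, he, pow_add]
    field_simp
  rw [hx, abs_div, abs_of_pos (by positivity : (0 : ℝ) < 2 * (r : ℝ) ^ (e + 2)),
    le_div_iff₀ (by positivity)]
  refine le_trans ?_ hdist
  have hpow : (r : ℝ) ^ (e + 2) ≤ (r : ℝ) ^ (L + 2) := pow_le_pow_right₀ (by linarith) heL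
  calc 1 / (r : ℝ) ^ (2 * L + 2) * (2 * (r : ℝ) ^ (e + 2))
      ≤ 1 / (r : ℝ) ^ (2 * L + 2) * (2 * (r : ℝ) ^ (L + 2)) := by gcongr
    _ = 2 / (r : ℝ) ^ L := by
      rw [show 2 * L + 2 = L + (L + 2) by ring, pow_add]; field_simp

theorem sum_tentSlope_blockSeq_le (i : ℕ) :
    ∑ k ∈ Finset.range (i * (m + 1 + 3)),
      tentSlope ((r : ℝ) ^ k * Real.ofDigits (blockSeq hr b)) ≤ -i := by
  have hr0 : (0 : ℝ) < r := by positivity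
  induction i with
  | zero => simp
  | succ i ih =>
    obtain ⟨W, hW, hslope⟩ := exists_pow_mul_ofDigits_blockSeq hr b i
    obtain ⟨hη0, hη1⟩ := ofDigits_blockSeq_mem_Icc hr fun k => b (k + (i + 1))
    have hq : 0 < 1 / (r : ℝ) ^ (m + 1 + 3) := by positivity
    have hblock := sum_tentSlope_block_le hr (m + 1) W (hq.le.trans hη0) (by linarith)
    rw [← hW] at hblock
    rw [add_one_mul, Finset.sum_range_add]
    have : ∀ j, (r : ℝ) ^ (i * (m + 1 + 3) + j) * Real.ofDigits (blockSeq hr b) =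
        (r : ℝ) ^ j * (((r : ℝ) ^ (m + 1 + 3)) ^ (i + 1) * Real.ofDigits (blockSeq hr b) /
          (r : ℝ) ^ (m + 1 + 3)) := by
      intro j
      have hpow : (r : ℝ) ^ (i * (m + 1 + 3) + j) = (r : ℝ) ^ j * ((r : ℝ) ^ (m + 1 + 3)) ^ i := by
        rw [pow_add, mul_comm i, pow_mul, mul_comm]
      rw [hpow, pow_succ _ i, mul_right_comm (((r : ℝ) ^ (m + 1 + 3)) ^ i),
        mul_div_cancel_right₀ _ (by positivity), mul_assoc]
    simp only [this]
    push_cast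
    linarith

theorem tendsto_sum_tentSlope_blockSeq :
    Tendsto (fun n => ∑ k ∈ Finset.range n,
      tentSlope ((r : ℝ) ^ k * Real.ofDigits (blockSeq hr b))) atTop atBot := by
  have hsum := sum_tentSlope_blockSeq_le hr b
  generalize Real.ofDigits (blockSeq hr b) = x at hsum ⊢
  set L := m + 1 + 3 with hL
  have hL0 : L ≠ 0 := by omega
  refine tendsto_atBot_mono (f := fun n : ℕ => -((n / L : ℕ) : ℝ) + L) (fun n => ?_) ?_
  · show ∑ k ∈ Finset.range n, tentSlope ((r : ℝ) ^ k * x) ≤ -((n / L : ℕ) : ℝ) + L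
    conv_lhs => rw [← Nat.div_add_mod' n L, Finset.sum_range_add]
    refine add_le_add (hsum (n / L)) ?_
    refine (Finset.sum_le_card_nsmul _ _ 1 fun k _ => tentSlope_le_one _).trans ?_
    rw [Finset.card_range, nsmul_one]
    exact_mod_cast (Nat.mod_lt n (by omega)).le
  · exact tendsto_atBot_add_const_right _ _ (tendsto_neg_atTop_atBot.comp
      (tendsto_natCast_atTop_atTop.comp (Nat.tendsto_div_const_atTop hL0)))

theorem hasDerivNegInf_ofDigits_blockSeq :
    HasDerivNegInf (takagiVdW r) (Real.ofDigits (blockSeq hr b)) :=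
  hasDerivNegInf_takagiVdW hr (by positivity) (le_abs_pow_mul_ofDigits_blockSeq_sub hr b)
    (tendsto_sum_tentSlope_blockSeq hr b)

end BlockSeq

/-! ### Hausdorff dimension -/

/-- The map from a point of the Cantor set to the number with the underlying symbol sequence as
digits in base `r ^ m` is Hölder continuous with exponent `m / (m + 4)`. -/
theorem abs_ofDigits_sub_le_rpow {r m : ℕ} (hr : 2 ≤ r) (b c : ℕ → Fin (r ^ m)) :
    |Real.ofDigits b - Real.ofDigits c| ≤ (r : ℝ) ^ m *
      |Real.ofDigits (blockSeq hr b) - Real.ofDigits (blockSeq hr c)| ^ ((m : ℝ) / (m + 4)) := by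
  by_cases hbc : b = c
  · subst hbc
    simp only [sub_self, abs_zero]
    positivity
  have hr0 : (0 : ℝ) < r := by positivity
  have hex : ∃ n, b n ≠ c n := Function.ne_iff.1 hbc
  classical
  set n := Nat.find hex with hn
  have hne : b n ≠ c n := Nat.find_spec hex
  have heq : ∀ i < n, b i = c i := fun i hi => not_not.1 (Nat.find_min hex hi)
  have hsep : (2 : ℝ) ≤ |((blockSeq hr b n : ℕ) : ℝ) - (blockSeq hr c n : ℕ)| := by
    have hw : descendingWord r (m + 1) (b n) ≠ descendingWord r (m + 1) (c n) := fun h =>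
      hne (Fin.ext (descendingWord_inj (two_mul_lt_pow_succ hr (b n).2)
        (two_mul_lt_pow_succ hr (c n).2) h))
    simp only [blockSeq, cast_blockDigit]
    generalize descendingWord r (m + 1) (b n) = u at hw
    generalize descendingWord r (m + 1) (c n) = v at hw
    have h1 : (1 : ℝ) ≤ |(u : ℝ) - v| := by
      have : (1 : ℤ) ≤ |(u : ℤ) - v| := Int.one_le_abs (by omega)
      exact_mod_cast this
    have h2 : (2 : ℝ) ≤ (r : ℝ) ^ 3 := by
      exact_mod_cast hr.trans (Nat.le_self_pow three_ne_zero r)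
    rw [show ((u : ℝ) + 1) * (r : ℝ) ^ 3 - r - ((v + 1) * (r : ℝ) ^ 3 - r) =
      (u - v) * (r : ℝ) ^ 3 by ring, abs_mul, abs_of_pos (by positivity : (0 : ℝ) < (r : ℝ) ^ 3)]
    nlinarith
  have hlow := inv_pow_le_abs_ofDigits_sub (d := blockSeq hr b) (e := blockSeq hr c)
    (fun i hi => by simp only [blockSeq, heq i hi]) hsep
  refine (Real.abs_ofDigits_sub_ofDigits_le heq).trans ?_
  have hpow : (((r ^ (m + 1 + 3) : ℕ) : ℝ) ^ (n + 1))⁻¹ ^ ((m : ℝ) / (m + 4)) =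
      ((r : ℝ) ^ (m * (n + 1)))⁻¹ := by
    have hm : (m : ℝ) + 4 ≠ 0 := by positivity
    push_cast
    rw [← pow_mul, Real.inv_rpow (by positivity), ← Real.rpow_natCast, ← Real.rpow_mul hr0.le,
      ← Real.rpow_natCast]
    congr 2
    push_cast
    field_simp
    ring
  calc (((r ^ m : ℕ) : ℝ) ^ n)⁻¹ = (r : ℝ) ^ m * ((r : ℝ) ^ (m * (n + 1)))⁻¹ := by
        push_cast
        rw [← pow_mul, mul_add, pow_add, mul_one]
        field_simp
    _ ≤ _ := by
        rw [← hpow]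
        gcongr

/-- The map of `abs_ofDigits_sub_le_rpow` is onto `[0,1]`, which bounds the dimension of its domain
from below. -/
theorem div_le_dimH_range_ofDigits_blockSeq {r m : ℕ} (hr : 2 ≤ r) (hm : m ≠ 0) :
    (((m : NNReal) / (m + 4) : NNReal) : ENNReal) ≤
      dimH (range fun b : ℕ → Fin (r ^ m) => Real.ofDigits (blockSeq hr b)) := by
  set φ : (ℕ → Fin (r ^ m)) → ℝ := fun b => Real.ofDigits (blockSeq hr b) with hφ
  have hB : 1 < r ^ m := Nat.one_lt_pow hm (by omega)
  have : NeZero (r ^ m) := ⟨by omega⟩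
  set s : NNReal := (m : NNReal) / (m + 4) with hs
  have hs0 : 0 < s := by have := Nat.pos_of_ne_zero hm; positivity
  have hs' : (s : ℝ) = (m : ℝ) / (m + 4) := by rw [hs]; push_cast; rfl
  let g : ℝ → ℝ := fun x => Real.ofDigits (Function.invFun φ x)
  have hφinv : ∀ b, φ (Function.invFun φ (φ b)) = φ b := fun b => Function.invFun_eq ⟨b, rfl⟩
  -- by the Hölder bound `g` does not depend on the choice of the preimage
  have hg : ∀ b, g (φ b) = Real.ofDigits b := by
    intro b
    have h := abs_ofDigits_sub_le_rpow hr (Function.invFun φ (φ b)) b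
    have h2 : Real.ofDigits (blockSeq hr (Function.invFun φ (φ b))) =
      Real.ofDigits (blockSeq hr b) := hφinv b
    have hmpos : 0 < (m : ℝ) := by exact_mod_cast Nat.pos_of_ne_zero hm
    rw [h2, sub_self, abs_zero, Real.zero_rpow (by positivity), mul_zero, abs_nonpos_iff,
      sub_eq_zero] at h
    exact h
  have hhold : HolderOnWith ((r : NNReal) ^ m) s g (range φ) := by
    rintro _ ⟨b, rfl⟩ _ ⟨c, rfl⟩
    rw [hg, hg, edist_dist, edist_dist, Real.dist_eq, Real.dist_eq,
      ENNReal.ofReal_rpow_of_nonneg (abs_nonneg _) s.coe_nonneg, ← ENNReal.ofReal_coe_nnreal,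
      ← ENNReal.ofReal_mul (by positivity)]
    refine ENNReal.ofReal_le_ofReal ?_
    rw [hs']
    push_cast
    exact abs_ofDigits_sub_le_rpow hr b c
  have himage : Icc (0 : ℝ) 1 ⊆ g '' range φ := by
    intro y hy
    obtain ⟨b, -, rfl⟩ := Real.ofDigits_SurjOn hB hy
    exact ⟨φ b, ⟨b, rfl⟩, hg b⟩
  have hdim : (1 : ENNReal) ≤ dimH (range φ) / s := by
    refine le_trans ?_ (hhold.dimH_image_le hs0)
    refine le_trans ?_ (dimH_mono himage)
    rw [Real.dimH_of_nonempty_interior (by rw [interior_Icc]; exact nonempty_Ioo.2 one_pos)]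
    simp
  rwa [ENNReal.le_div_iff_mul_le (Or.inl (by exact_mod_cast hs0.ne')) (Or.inl ENNReal.coe_ne_top),
    one_mul] at hdim

theorem tendsto_natCast_div_add_four :
    Tendsto (fun m : ℕ => (((m : NNReal) / (m + 4) : NNReal) : ENNReal)) atTop (𝓝 1) := by
  rw [← ENNReal.coe_one, ENNReal.tendsto_coe, ← NNReal.tendsto_coe]
  push_cast
  exact tendsto_natCast_div_add_atTop (4 : ℝ)

theorem mainTheorem4 (r : ℕ) (hr : 2 ≤ r) :
    volume {x : ℝ | x ∈ Icc (0 : ℝ) 1 ∧ HasDerivNegInf (takagiVdW r) x} = 0 ∧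
      dimH {x : ℝ | x ∈ Icc (0 : ℝ) 1 ∧ HasDerivNegInf (takagiVdW r) x} = 1 := by
  refine ⟨volume_hasDerivNegInf _, le_antisymm ?_ ?_⟩
  · exact (dimH_mono (subset_univ _)).trans_eq Real.dimH_univ
  · refine le_of_tendsto tendsto_natCast_div_add_four ?_
    filter_upwards [eventually_ne_atTop 0] with m hm
    refine (div_le_dimH_range_ofDigits_blockSeq hr hm).trans (dimH_mono ?_)
    rintro _ ⟨b, rfl⟩
    exact ⟨⟨Real.ofDigits_nonneg _, Real.ofDigits_le_one _⟩, hasDerivNegInf_ofDigits_blockSeq hr b⟩
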